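/- Let $g \ge 2$ and $n \ge 2$ be integers. The staircase surface $L_g^n$ is the following translation surface, tiled by $g(n+1)-1$ unit squares, of genus $g$ and with a single conical point. Take $g$ long rectangles $R_1,\dots,R_g$, where $R_i$ consists of $n$ unit squares in a vertical column if $i$ is odd and in a horizontal row if $i$ is even, and $g-1$ corner squares $C_1,\dots,C_{g-1}$. Arrange them as a staircase descending to the right: for odd $i$, the squares $C_{i-1}$, $R_i$, $C_i$ form a vertical strip, from top to bottom, and for even $i$ the squares $C_{i-1}$, $R_i$, $C_i$ form a horizontal strip, from left to right (for $i=1$ there is no $C_{i-1}$, and for $i=g$ there is no $C_i$). Opposite boundary sides of this polygon are glued by translations so that each maximal vertical strip and each maximal horizontal strip of squares is a cylinder; in particular, a square of a vertical (resp. horizontal) $R_i$ has its left and right (resp. top and bottom) sides glued to each other. A saddle connection on $L_g^n$ is an oriented geodesic segment joining the conical point to itself, with no conical point in its interior; it is a closed curve. Let $l$ denote length in the flat metric and $\mathrm{Int}$ the algebraic intersection form on $H_1(L_g^n,\mathbb{R})$. Then for any two saddle connections $\alpha,\beta$ on $L_g^n$, $$\frac{\mathrm{Int}(\alpha,\beta)}{l(\alpha)\,l(\beta)}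 \;\le\; \frac1n\left(\frac{n+1}{n}\right)^2+\frac{6}{n^2}.$$ -/

import Mathlib

/-- A square-tiled surface: unit squares indexed by `Q`, the right side of `q` being glued by
translation to the left side of `right q`, and the top side of `q` to the bottom side of `up q`. -/
structure Origami (Q : Type) where
  right : Equiv.Perm Q
  up : Equiv.Perm Q

namespace Origami

variable {Q : Type}

/-- A point of one of the closed unit squares: the square, then the two coordinates. -/
abbrev Pt (Q : Type) : Type := Q × unitInterval × unitInterval

/-- The elementary gluings of the sides of the squares. -/
inductive Glue (O : Origami Q) : Pt Q → Pt Q → Prop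
  | right (q : Q) (y : unitInterval) : Glue O (q, 1, y) (O.right q, 0, y)
  | up (q : Q) (x : unitInterval) : Glue O (q, x, 1) (O.up q, x, 0)

/-- The surface: the disjoint union of the closed squares modulo the gluings. -/
def Surface (O : Origami Q) : Type := Quot O.Glue

def pt (O : Origami Q) (p : Pt Q) : O.Surface := Quot.mk _ p

/-- The lower left corner of a square, as a point of the surface. -/
def corner (O : Origami Q) (q : Q) : O.Surface := O.pt (q, 0, 0)

/-- The number of squares having `P` as lower left corner. A vertex of the tiling of cone angle
`2πk` is the lower left corner of exactly `k` squares; a point that is not a vertex of the tiling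
(which is never singular) gets the value `0`. -/
noncomputable def coneMultiplicity (O : Origami Q) (P : O.Surface) : ℕ :=
  Nat.card {q : Q // O.corner q = P}

/-- Singularities (conical points): the vertices of cone angle greater than `2π`. -/
def IsSingular (O : Origami Q) (P : O.Surface) : Prop := 2 ≤ O.coneMultiplicity P

/-! ### Polygonal paths and saddle connections -/

/-- An oriented straight segment inside one closed square. -/
structure Chord (Q : Type) where
  sq : Q
  src : unitInterval × unitInterval
  tgt : unitInterval × unitInterval

namespace Chord

def dx (c : Chord Q) : ℝ := (c.tgt.1 : ℝ) - c.src.1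

def dy (c : Chord Q) : ℝ := (c.tgt.2 : ℝ) - c.src.2

noncomputable def length (c : Chord Q) : ℝ := √(c.dx ^ 2 + c.dy ^ 2)

def srcPt (O : Origami Q) (c : Chord Q) : O.Surface := O.pt (c.sq, c.src)

def tgtPt (O : Origami Q) (c : Chord Q) : O.Surface := O.pt (c.sq, c.tgt)

end Chord

/-- A polygonal path on the surface: finitely many chords, each starting at the point of the
surface where the previous one ends. -/
structure PolyPath (O : Origami Q) where
  chords : List (Chord Q)
  ne_nil : chords ≠ []
  chain : chords.IsChain (fun c d => c.tgtPt O = d.srcPt O)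

namespace PolyPath

variable {O : Origami Q}

def source (γ : PolyPath O) : O.Surface := (γ.chords.head γ.ne_nil).srcPt O

def target (γ : PolyPath O) : O.Surface := (γ.chords.getLast γ.ne_nil).tgtPt O

def IsClosed (γ : PolyPath O) : Prop := γ.source = γ.target

noncomputable def length (γ : PolyPath O) : ℝ := (γ.chords.map Chord.length).sum

end PolyPath

/-- An (oriented) saddle connection: a geodesic segment which joins two singularities and has no
singularity in its interior. It is cut into finitely many chords, all positively proportional to
one nonzero vector `(vx, vy)`. The interior of such a chord contains no corner of its square, so
that only the junctions of consecutive chords have to be required to be regular; at a regular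
point, leaving in the direction `(vx, vy)` in which one arrived means going straight on. -/
structure SaddleConnection (O : Origami Q) extends PolyPath O where
  vx : ℝ
  vy : ℝ
  dir_ne_zero : (vx, vy) ≠ 0
  straight : ∀ c ∈ chords, ∃ t : ℝ, 0 < t ∧ c.dx = t * vx ∧ c.dy = t * vy
  source_singular : O.IsSingular toPolyPath.source
  target_singular : O.IsSingular toPolyPath.target
  interior_regular : chords.IsChain (fun c _ => ¬ O.IsSingular (c.tgtPt O))

/-! ### First cohomology, Poincaré duality and algebraic intersection

The cohomology with real coefficients is computed by the cellular cochains of the tiling. Every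
edge is the bottom side of exactly one square or the left side of exactly one square, so a
1-cochain is a pair `(a, b)` of functions on `Q`: `a q` is its value on the bottom side of `q`
(oriented to the right) and `b q` its value on the left side of `q` (oriented upwards). -/

abbrev Cochain (Q : Type) : Type := (Q → ℝ) × (Q → ℝ)

/-- The coboundary of a 1-cochain: its sum along the positively oriented boundary of a square. -/
def coboundary (O : Origami Q) : Cochain Q →ₗ[ℝ] (Q → ℝ) where
  toFun φ q := φ.1 q + φ.2 (O.right q) - φ.1 (O.up q) - φ.2 q
  map_add' φ ψ := by ext q; simp; ring
  map_smul' t φ := by ext q; simp; ring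

/-- The closed 1-cochains. -/
def cocycles (O : Origami Q) : Submodule ℝ (Cochain Q) := LinearMap.ker O.coboundary

/-- The (cubical) cup product of two 1-cochains, evaluated on the fundamental class. On cocycles
it is the integral over the surface of the wedge product of the corresponding closed forms. -/
def cup [Fintype Q] (O : Origami Q) : Cochain Q →ₗ[ℝ] Cochain Q →ₗ[ℝ] ℝ :=
  LinearMap.mk₂ ℝ (fun φ ψ => ∑ q, (φ.1 q * ψ.2 (O.right q) - φ.2 q * ψ.1 (O.up q)))
    (fun φ φ' ψ => by rw [← Finset.sum_add_distrib]; congr 1; ext q; simp; ring)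
    (fun t φ ψ => by simp only [smul_eq_mul, Finset.mul_sum]; congr 1; ext q; simp; ring)
    (fun φ ψ ψ' => by rw [← Finset.sum_add_distrib]; congr 1; ext q; simp; ring)
    (fun t φ ψ => by simp only [smul_eq_mul, Finset.mul_sum]; congr 1; ext q; simp; ring)

/-- A cocycle represents the closed 1-form whose primitive on the square `q` is the function that
is affine in each coordinate, vanishes at the lower left corner and increases along each side by
the value of the cocycle on that side. -/
def primitive (O : Origami Q) (p : Pt Q) : Cochain Q →ₗ[ℝ] ℝ where
  toFun φ := (p.2.1 : ℝ) * (1 - p.2.2) * φ.1 p.1 + (1 - p.2.1) * p.2.2 * φ.2 p.1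
    + p.2.1 * p.2.2 * (φ.1 p.1 + φ.2 (O.right p.1))
  map_add' φ ψ := by simp; ring
  map_smul' t φ := by simp; ring

/-- The integral of (the closed 1-form represented by) a cocycle along a list of chords. -/
def integral (O : Origami Q) (l : List (Chord Q)) : Cochain Q →ₗ[ℝ] ℝ :=
  (l.map (fun c => O.primitive (c.sq, c.tgt) - O.primitive (c.sq, c.src))).sum

/-- `η` is Poincaré dual to the closed curve `γ`: it is closed, and `∫_γ ψ = ∫ ψ ∧ η` for every
closed `ψ`. -/
def IsPoincareDual [Fintype Q] {O : Origami Q} (γ : PolyPath O) (η : Cochain Q) : Prop :=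
  η ∈ O.cocycles ∧ ∀ ψ ∈ O.cocycles, O.integral γ.chords ψ = O.cup ψ η

/-- A function on the set of squares that takes the same value at `up (right q)` and at
`right (up q)` only depends on the lower left corner of a square; its extension to the surface,
affine in each coordinate on each square. -/
noncomputable def extend (O : Origami Q) (σ : Q → ℝ)
    (h : ∀ q, σ (O.up (O.right q)) = σ (O.right (O.up q))) : O.Surface → ℝ :=
  Quot.lift (fun p => (1 - (p.2.1 : ℝ)) * (1 - p.2.2) * σ p.1 + p.2.1 * (1 - p.2.2) * σ (O.right p.1)
      + (1 - p.2.1) * p.2.2 * σ (O.up p.1) + p.2.1 * p.2.2 * σ (O.up (O.right p.1))) (by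
    rintro _ _ (⟨q, y⟩ | ⟨q, x⟩)
    · simp
    · simp [h])

theorem integral_exact {O : Origami Q} (γ : PolyPath O) (hγ : γ.IsClosed) (σ : Q → ℝ)
    (ψ : Cochain Q) (hψ : ψ ∈ O.cocycles) (h1 : ∀ q, ψ.1 q = σ (O.right q) - σ q)
    (h2 : ∀ q, ψ.2 q = σ (O.up q) - σ q) : O.integral γ.chords ψ = 0 := by
  have h : ∀ q, σ (O.up (O.right q)) = σ (O.right (O.up q)) := by
    intro q
    have := congrFun (LinearMap.mem_ker.1 hψ) q
    simp only [coboundary, LinearMap.coe_mk, AddHom.coe_mk, h1, h2, Pi.zero_apply] at this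
    linarith
  have key : ∀ c : Chord Q,
      (O.primitive (c.sq, c.tgt) - O.primitive (c.sq, c.src)) ψ
        = O.extend σ h (c.tgtPt O) - O.extend σ h (c.srcPt O) := by
    intro c
    simp only [LinearMap.sub_apply, primitive, LinearMap.coe_mk, AddHom.coe_mk, h1, h2,
      Chord.tgtPt, Chord.srcPt, pt, extend]
    ring
  have tel : ∀ (l : List (Chord Q)) (hl : l ≠ []),
      l.IsChain (fun c d => c.tgtPt O = d.srcPt O) →
      O.integral l ψ = O.extend σ h ((l.getLast hl).tgtPt O)
        - O.extend σ h ((l.head hl).srcPt O) := by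
    intro l
    induction l with
    | nil => intro hl; exact absurd rfl hl
    | cons c l ih =>
      intro hl hc
      have hstep : O.integral (c :: l) ψ
          = (O.primitive (c.sq, c.tgt) - O.primitive (c.sq, c.src)) ψ + O.integral l ψ := by
        simp only [integral, List.map_cons, List.sum_cons, LinearMap.add_apply]
      rw [hstep, key c]
      cases l with
      | nil => simp [integral]
      | cons d l =>
        rw [List.isChain_cons_cons] at hc
        rw [ih (by simp) hc.2]
        simp [hc.1]
  have hcl : γ.source = γ.target := hγ
  rw [tel γ.chords γ.ne_nil γ.chain]
  change O.extend σ h γ.target - O.extend σ h γ.source = 0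
  rw [hcl, sub_self]

theorem exists_coeff [Fintype Q] (O : Origami Q) (f : Cochain Q →ₗ[ℝ] ℝ)
    (hf : ∀ η ∈ O.cocycles, f η = 0) :
    ∃ σ : Q → ℝ, ∀ η, f η = ∑ q, σ q * O.coboundary η q := by
  classical
  have h : f ∈ LinearMap.range O.coboundary.dualMap := by
    rw [LinearMap.range_dualMap_eq_dualAnnihilator_ker, Submodule.mem_dualAnnihilator]
    exact hf
  obtain ⟨s, rfl⟩ := h
  refine ⟨fun q => s (Pi.single q 1), fun η => ?_⟩
  rw [LinearMap.dualMap_apply, LinearMap.pi_apply_eq_sum_univ s]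
  refine Finset.sum_congr rfl fun q _ => ?_
  rw [smul_eq_mul, mul_comm]
  congr 2
  ext j
  simp [Pi.single_apply, eq_comm]

theorem exact_of_cup_left [Fintype Q] (O : Origami Q) (ψ : Cochain Q)
    (h : ∀ η ∈ O.cocycles, O.cup ψ η = 0) :
    ∃ σ : Q → ℝ, (∀ q, ψ.1 q = σ (O.right q) - σ q) ∧ (∀ q, ψ.2 q = σ (O.up q) - σ q) := by
  classical
  obtain ⟨σ, hσ⟩ := O.exists_coeff (O.cup ψ) h
  refine ⟨fun q => - σ q, fun q => ?_, fun q => ?_⟩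
  · have := hσ (0, Pi.single (O.right q) 1)
    simp [cup, coboundary, Pi.single_apply, mul_sub, Finset.sum_sub_distrib] at this
    linarith
  · have := hσ (Pi.single (O.up q) 1, 0)
    simp [cup, coboundary, Pi.single_apply, mul_sub, Finset.sum_sub_distrib] at this
    linarith

theorem exact_of_cup_right [Fintype Q] (O : Origami Q) (ψ : Cochain Q) (hψ : ψ ∈ O.cocycles)
    (h : ∀ η ∈ O.cocycles, O.cup η ψ = 0) :
    ∃ σ : Q → ℝ, (∀ q, ψ.1 q = σ (O.right q) - σ q) ∧ (∀ q, ψ.2 q = σ (O.up q) - σ q) := by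
  classical
  obtain ⟨σ, hσ⟩ := O.exists_coeff (O.cup.flip ψ) h
  have h2 : ∀ q, ψ.2 (O.right q) = σ q - σ (O.up.symm q) := by
    intro q
    have := hσ (Pi.single q 1, 0)
    simp [cup, coboundary, Pi.single_apply, mul_sub, Finset.sum_sub_distrib,
      ← Equiv.eq_symm_apply] at this
    linarith
  have h1 : ∀ q, ψ.1 (O.up q) = σ q - σ (O.right.symm q) := by
    intro q
    have := hσ (0, Pi.single q 1)
    simp [cup, coboundary, Pi.single_apply, mul_sub, Finset.sum_sub_distrib,
      ← Equiv.eq_symm_apply] at this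
    linarith
  have h1' : ∀ q, ψ.1 q = σ (O.up.symm q) - σ (O.right.symm (O.up.symm q)) := by
    intro q; simpa using h1 (O.up.symm q)
  have h2' : ∀ q, ψ.2 q = σ (O.right.symm q) - σ (O.up.symm (O.right.symm q)) := by
    intro q; simpa using h2 (O.right.symm q)
  have hc : ∀ q, σ (O.right.symm (O.up.symm q)) = σ (O.up.symm (O.right.symm q)) := by
    intro q
    have := congrFun (LinearMap.mem_ker.1 hψ) q
    simp only [coboundary, LinearMap.coe_mk, AddHom.coe_mk, h1, h2, Pi.zero_apply] at this
    rw [h1', h2'] at this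
    linarith
  refine ⟨fun q => σ (O.up.symm (O.right.symm q)), fun q => ?_, fun q => ?_⟩
  · rw [h1' q, hc q]; simp
  · rw [h2' q]; simp only []; rw [← hc (O.up q)]; simp

/-- Every closed curve has a Poincaré dual. -/
theorem exists_poincareDual [Fintype Q] {O : Origami Q} (γ : PolyPath O) (hγ : γ.IsClosed) :
    ∃ η, IsPoincareDual γ η := by
  let Z := O.cocycles
  let B : Z →ₗ[ℝ] Module.Dual ℝ Z := (O.cup.domRestrict₁₂ Z Z)
  let L : Module.Dual ℝ Z := (O.integral γ.chords).domRestrict Z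
  have h : L ∈ LinearMap.range B.dualMap := by
    rw [LinearMap.range_dualMap_eq_dualAnnihilator_ker, Submodule.mem_dualAnnihilator]
    intro ψ hψ
    have hψ' : ∀ η ∈ O.cocycles, O.cup ψ.1 η = 0 := fun η hη =>
      LinearMap.congr_fun (LinearMap.mem_ker.1 hψ) (⟨η, hη⟩ : Z)
    obtain ⟨σ, h1, h2⟩ := O.exact_of_cup_left ψ.1 hψ'
    exact integral_exact γ hγ σ ψ.1 ψ.2 h1 h2
  obtain ⟨e, he⟩ := h
  obtain ⟨η, rfl⟩ := (Module.evalEquiv ℝ Z).surjective e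
  exact ⟨η.1, η.2, fun ψ hψ => (LinearMap.congr_fun he (⟨ψ, hψ⟩ : Z)).symm⟩

/-- A Poincaré dual of a closed curve (unique up to coboundaries). -/
noncomputable def poincareDual [Fintype Q] {O : Origami Q} (γ : PolyPath O) (hγ : γ.IsClosed) :
    Cochain Q := (exists_poincareDual γ hγ).choose

/-- The algebraic intersection of two closed curves: `∫ η_γ ∧ η_δ`, where `η_γ` and `η_δ` are
Poincaré dual to `γ` and `δ`. -/
noncomputable def algInt [Fintype Q] {O : Origami Q} (γ δ : PolyPath O)
    (hγ : γ.IsClosed) (hδ : δ.IsClosed) : ℝ :=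
  O.cup (poincareDual γ hγ) (poincareDual δ hδ)

/-- The algebraic intersection does not depend on the choice of the Poincaré duals. -/
theorem algInt_eq [Fintype Q] {O : Origami Q} (γ δ : PolyPath O)
    (hγ : γ.IsClosed) (hδ : δ.IsClosed) {η θ : Cochain Q}
    (hη : IsPoincareDual γ η) (hθ : IsPoincareDual δ θ) :
    algInt γ δ hγ hδ = O.cup η θ := by
  have h1 : IsPoincareDual γ (poincareDual γ hγ) := (exists_poincareDual γ hγ).choose_spec
  have h2 : IsPoincareDual δ (poincareDual δ hδ) := (exists_poincareDual δ hδ).choose_spec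
  have hd : poincareDual γ hγ - η ∈ O.cocycles := O.cocycles.sub_mem h1.1 hη.1
  obtain ⟨σ, e1, e2⟩ := O.exact_of_cup_right _ hd (fun ψ hψ => by
    rw [map_sub, ← h1.2 ψ hψ, ← hη.2 ψ hψ, sub_self])
  have := integral_exact δ hδ σ _ hd e1 e2
  rw [map_sub, h2.2 _ h1.1, hθ.2 _ hη.1] at this
  exact sub_eq_zero.1 this

end Origami

/-! ### The staircase surface -/

/-- The squares of the staircase with `g` long rectangles of length `n`: for `k < n`, `(j, k)` is
the `k`-th square of the long rectangle number `j` (`0 ≤ j < g`), and `(j, n)` with `j + 1 < g` is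
the corner square between the long rectangles `j` and `j + 1`. The long rectangles with even `j`
are vertical (their squares numbered downwards), those with odd `j` are horizontal (their squares
numbered from left to right). -/
abbrev StairSq (g n : ℕ) : Type := {p : ℕ × ℕ // p.1 < g ∧ p.2 ≤ n ∧ (p.2 = n → p.1 + 1 < g)}

instance (g n : ℕ) : Finite (StairSq g n) :=
  Finite.of_injective
    (fun p => ((⟨p.1.1, p.2.1⟩, ⟨p.1.2, Nat.lt_succ_of_le p.2.2.1⟩) : Fin g × Fin (n + 1)))
    (by rintro ⟨⟨a, b⟩, h⟩ ⟨⟨c, d⟩, h'⟩ e; simp at e; simp [e])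

noncomputable instance (g n : ℕ) : Fintype (StairSq g n) := Fintype.ofFinite _

namespace Staircase

/-- The maximal strip number `j` of the staircase consists of the corner square `(j - 1, n)` (if
`0 < j`), the long rectangle `j` and the corner square `(j, n)` (if `j + 1 < g`), in this order.
This is its first square. -/
def first (n j : ℕ) : ℕ × ℕ := if j = 0 then (0, 0) else (j - 1, n)

/-- This is the last square of the strip number `j`. -/
def last (g n j : ℕ) : ℕ × ℕ := if j + 1 < g then (j, n) else (j, n - 1)

/-- For `e = 0` (vertical strips) or `e = 1` (horizontal strips): the next square in the strip of
parity `e` containing the given square, cyclically. A square that lies in no strip of parity `e`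
forms a cylinder of circumference one and is its own successor. -/
def next (g n e : ℕ) (p : ℕ × ℕ) : ℕ × ℕ :=
  if p.2 < n then
    if p.1 % 2 = e then
      if p = last g n p.1 then first n p.1 else (p.1, p.2 + 1)
    else p
  else
    if p.1 % 2 = e then first n p.1 else (p.1 + 1, 0)

/-- The previous square, cyclically. -/
def prev (g n e : ℕ) (p : ℕ × ℕ) : ℕ × ℕ :=
  if p.2 < n then
    if p.1 % 2 = e then
      if p = first n p.1 then last g n p.1 else if p.2 = 0 then first n p.1 else (p.1, p.2 - 1)
    else p
  else
    if p.1 % 2 = e then (p.1, n - 1) else last g n (p.1 + 1)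

/-- The cyclic permutation of the squares of each strip of parity `e`. -/
def shift (g n : ℕ) (hn : 0 < n) (e : Fin 2) : Equiv.Perm (StairSq g n) where
  toFun p := ⟨next g n e p.1, by
    obtain ⟨⟨j, k⟩, h1, h2, h3⟩ := p
    simp only [next, first, last]
    grind⟩
  invFun p := ⟨prev g n e p.1, by
    obtain ⟨⟨j, k⟩, h1, h2, h3⟩ := p
    simp only [prev, first, last]
    grind⟩
  left_inv p := by
    obtain ⟨⟨j, k⟩, h1, h2, h3⟩ := p
    simp only [Subtype.mk.injEq, prev, next, first, last]
    grind
  right_inv p := by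
    obtain ⟨⟨j, k⟩, h1, h2, h3⟩ := p
    simp only [Subtype.mk.injEq, prev, next, first, last]
    grind

end Staircase

/-- The staircase surface. -/
def staircase (g n : ℕ) (hn : 0 < n) : Origami (StairSq g n) where
  right := Staircase.shift g n hn 1
  up := (Staircase.shift g n hn 0).symm

theorem Origami.corner_comm {Q : Type} (O : Origami Q) (q : Q) :
    O.corner (O.up (O.right q)) = O.corner (O.right (O.up q)) := by
  have h1 : O.pt (q, 1, 1) = O.pt (O.right q, 0, 1) := Quot.sound (Origami.Glue.right q 1)
  have h2 : O.pt (O.right q, 0, 1) = O.pt (O.up (O.right q), 0, 0) :=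
    Quot.sound (Origami.Glue.up (O.right q) 0)
  have h3 : O.pt (q, 1, 1) = O.pt (O.up q, 1, 0) := Quot.sound (Origami.Glue.up q 1)
  have h4 : O.pt (O.up q, 1, 0) = O.pt (O.right (O.up q), 0, 0) :=
    Quot.sound (Origami.Glue.right (O.up q) 0)
  exact (h2.symm.trans h1.symm).trans (h3.trans h4)

namespace Staircase

theorem corner_step (g n : ℕ) (hn : 0 < n) (q q' : StairSq g n)
    (h : q'.1 = next g n 1 (prev g n 0 (prev g n 1 (next g n 0 q.1)))) :
    (staircase g n hn).corner q = (staircase g n hn).corner q' := by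
  have := (staircase g n hn).corner_comm
    ((staircase g n hn).right.symm ((staircase g n hn).up.symm q))
  rw [Equiv.apply_symm_apply, Equiv.apply_symm_apply] at this
  rw [this]
  congr 1
  exact Subtype.ext h.symm

theorem corner_even (g n : ℕ) (hn : 0 < n) (i : ℕ) (hi : 2 * i < g) :
    (staircase g n hn).corner ⟨(2 * i, n - 1), by grind⟩
      = (staircase g n hn).corner ⟨(0, n - 1), by grind⟩ := by
  induction i with
  | zero => rfl
  | succ i ih =>
    rw [← ih (by omega)]
    by_cases h : 2 * i + 3 < g
    · rw [← corner_step g n hn ⟨(2 * i + 3, 0), by grind⟩ ⟨(2 * (i + 1), n - 1), by grind⟩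
        (by simp only [next, prev, first, last]; grind)]
      exact (corner_step g n hn _ _ (by simp only [next, prev, first, last]; grind)).symm
    · exact (corner_step g n hn _ _ (by simp only [next, prev, first, last]; grind)).symm

theorem corner_odd (g n : ℕ) (hn : 0 < n) (i : ℕ) (hi : 2 * i + 1 < g) :
    (staircase g n hn).corner ⟨(2 * i + 1, 0), by grind⟩
      = (staircase g n hn).corner ⟨(0, n - 1), by grind⟩ := by
  rw [← corner_even g n hn i (by omega)]
  exact corner_step g n hn _ _ (by simp only [next, prev, first, last]; grind)

theorem corner_core (g n : ℕ) (hn : 0 < n) (j : ℕ) (hj : j + 1 < g) :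
    (staircase g n hn).corner ⟨(j, n), by grind⟩
      = (staircase g n hn).corner ⟨(0, n - 1), by grind⟩ := by
  induction j with
  | zero =>
    rw [← corner_odd g n hn 0 (by omega)]
    exact corner_step g n hn _ _ (by simp only [next, prev, first, last]; grind)
  | succ j ih =>
    rw [← ih (by omega)]
    exact corner_step g n hn _ _ (by simp only [next, prev, first, last]; grind)

/-- The staircase surface has a single singularity. -/
theorem corner_of_singular (g n : ℕ) (hg : 0 < g) (hn : 0 < n) (P : (staircase g n hn).Surface)
    (hP : (staircase g n hn).IsSingular P) :
    P = (staircase g n hn).corner ⟨(0, n - 1), by grind⟩ := by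
  classical
  let O := staircase g n hn
  have : Nontrivial {q : StairSq g n // O.corner q = P} :=
    Finite.one_lt_card_iff_nontrivial.1 hP
  obtain ⟨⟨q, hq⟩, ⟨q', hq'⟩, hne⟩ := exists_pair_ne {q : StairSq g n // O.corner q = P}
  have hne' : q ≠ q' := fun e => hne (Subtype.ext e)
  rw [← hq]
  by_contra hb
  have hreg : prev g n 1 (next g n 0 q.1) = next g n 0 (prev g n 1 q.1) := by
    obtain ⟨⟨j, k⟩, h1, h2, h3⟩ := q
    have e1 : k = n → False := by
      rintro rfl; exact hb (corner_core g k hn j (h3 rfl))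
    have e2 : j % 2 = 0 → k = n - 1 → False := by
      intro a b
      obtain ⟨i, rfl⟩ : ∃ i, j = 2 * i := ⟨j / 2, by omega⟩
      subst b
      exact hb (corner_even g n hn i h1)
    have e3 : j % 2 = 1 → k = 0 → False := by
      intro a b
      obtain ⟨i, rfl⟩ : ∃ i, j = 2 * i + 1 := ⟨j / 2, by omega⟩
      subst b
      exact hb (corner_odd g n hn i h1)
    simp only [next, prev, first, last] at *
    grind
  have hreg' : O.right.symm (O.up.symm q) = O.up.symm (O.right.symm q) := Subtype.ext hreg
  let σ : StairSq g n → ℝ := fun p => if p = q then 1 else 0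
  have hσ : ∀ p, σ (O.up (O.right p)) = σ (O.right (O.up p)) := by
    intro p
    have : O.up (O.right p) = q ↔ O.right (O.up p) = q := by
      rw [← Equiv.eq_symm_apply, ← Equiv.eq_symm_apply, ← Equiv.eq_symm_apply,
        ← Equiv.eq_symm_apply, hreg']
    simp only [σ, this]
  have h : ∀ p, O.extend σ hσ (O.corner p) = σ p := by
    intro p; simp [Origami.extend, Origami.corner, Origami.pt]
  have := (h q).symm.trans ((congrArg _ (hq.trans hq'.symm)).trans (h q'))
  simp [σ, hne'.symm] at this

/-- Saddle connections on the staircase surface are closed curves. -/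
theorem saddle_isClosed {g n : ℕ} (hg : 0 < g) (hn : 0 < n)
    (α : (staircase g n hn).SaddleConnection) : α.toPolyPath.IsClosed :=
  (corner_of_singular g n hg hn _ α.source_singular).trans
    (corner_of_singular g n hg hn _ α.target_singular).symm

/-- The algebraic intersection of two saddle connections on the staircase surface. -/
noncomputable def inter {g n : ℕ} (hg : 0 < g) (hn : 0 < n)
    (α β : (staircase g n hn).SaddleConnection) : ℝ :=
  Origami.algInt α.toPolyPath β.toPolyPath (saddle_isClosed hg hn α) (saddle_isClosed hg hn β)

end Staircase

/-! The stronger inequality `n * |Int| ≤ l * l'` holds for any two closed polygonal curves, and `1 /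
n` is already below the stated bound. Straightness of the saddle connections plays no role beyond
their being closed.

On the staircase every cocycle takes equal values on opposite sides of each square (`cocycle_right`,
`cocycle_up`). It therefore represents a form that is constant on each square, and its integral
along a curve depends only on the displacement of the curve in each square (`integral_cocycle`). A
class is described by its value `transValue` across each strip and its value `longValue` along each
long rectangle, and `cup_eq` writes the cup product in these coordinates.

Pairing a Poincaré dual with two kinds of test cocycles computes its coordinates. A side glued to
its own square shows that `transValue η j` is, up to sign, the displacement along the strip in each
one of the `n` squares of the long rectangle (`transValue_dual_eq`); summing over these squares
produces the factor `n`. The class of a whole strip expresses `longValue η j` through transverse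
displacements and the `transValue` of the two neighbouring strips (`longValue_dual_eq`).

After substitution, the products coming from the corner squares cancel against half of the neighbour
terms. What remains is, for each long rectangle, the determinant of the two displacements in it, at
most the product of the lengths there, and products attached to adjacent pieces of the staircase.
Each ordered pair of pieces occurs at most once, so the total is at most the product of the two
lengths (`sum_adjacent_le`, `natCast_mul_abs_cup_le`). -/

open Finset

namespace Staircase

variable {g n : ℕ}

/-! ### Sums over the squares of the staircase -/

/-- The extension by zero of a function on the squares of the staircase to all pairs of indices. -/
noncomputable def ext {E : Type*} [Zero E] (f : StairSq g n → E) (p : ℕ × ℕ) : E :=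
  open Classical in
  if h : p.1 < g ∧ p.2 ≤ n ∧ (p.2 = n → p.1 + 1 < g) then f ⟨p, h⟩ else 0

theorem ext_of_valid {E : Type*} [Zero E] (f : StairSq g n → E) {p : ℕ × ℕ}
    (h : p.1 < g ∧ p.2 ≤ n ∧ (p.2 = n → p.1 + 1 < g)) : ext f p = f ⟨p, h⟩ := dif_pos h

theorem ext_coe {E : Type*} [Zero E] (f : StairSq g n → E) (q : StairSq g n) :
    ext f q.1 = f q := dif_pos q.2

theorem ext_of_not_valid {E : Type*} [Zero E] (f : StairSq g n → E) {p : ℕ × ℕ}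
    (h : ¬ (p.1 < g ∧ p.2 ≤ n ∧ (p.2 = n → p.1 + 1 < g))) : ext f p = 0 := dif_neg h

theorem sum_eq_sum_ext {E : Type*} [AddCommMonoid E] (f : StairSq g n → E) :
    ∑ q, f q = ∑ j ∈ range g, (∑ k ∈ range n, ext f (j, k) + ext f (j, n)) := by
  classical
  simp_rw [← sum_range_succ]
  rw [← sum_product']
  have h : ∀ p : ℕ × ℕ, p ∈ (range g ×ˢ range (n + 1)).filter
      (fun p => p.1 < g ∧ p.2 ≤ n ∧ (p.2 = n → p.1 + 1 < g)) ↔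
      p.1 < g ∧ p.2 ≤ n ∧ (p.2 = n → p.1 + 1 < g) := by
    intro p
    simp only [mem_filter, mem_product, mem_range]
    grind
  have h' := Finset.sum_subtype (F := inferInstanceAs (Fintype (StairSq g n))) _ h (ext f)
  -- The only pair in the rectangle of indices that is not a square is `(g - 1, n)`, where `ext` is
  -- zero.
  rw [sum_filter_of_ne] at h'
  · rw [h']
    exact sum_congr (by ext; simp) fun q _ => (ext_coe f q).symm
  · intro p _ hp
    by_contra hv
    exact hp (ext_of_not_valid f hv)

/-! ### Rigidity of cocycles -/

/-- The part of a cochain carried by the edges transverse to the strips of the parity of `j`. -/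
def trans (φ : Origami.Cochain (StairSq g n)) (j : ℕ) : StairSq g n → ℝ :=
  if j % 2 = 0 then φ.1 else φ.2

theorem trans_add_two (φ : Origami.Cochain (StairSq g n)) (j : ℕ) :
    trans φ (j + 2) = trans φ j := by simp [trans]

/-- The common value of a cocycle on the edges transverse to the strip `j`. -/
noncomputable def transValue (φ : Origami.Cochain (StairSq g n)) (j : ℕ) : ℝ :=
  ext (trans φ j) (j, 0)

/-- The value of a cochain along the long rectangle `j`. -/
noncomputable def longValue (φ : Origami.Cochain (StairSq g n)) (j : ℕ) : ℝ :=
  ∑ k ∈ range n, ext (trans φ (j + 1)) (j, k)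

theorem right_coe (hn : 0 < n) (q : StairSq g n) :
    ((staircase g n hn).right q).1 = next g n 1 q.1 := rfl

theorem up_coe (hn : 0 < n) (q : StairSq g n) :
    ((staircase g n hn).up q).1 = prev g n 0 q.1 := rfl

theorem cocycle_eq {hn : 0 < n} {φ : Origami.Cochain (StairSq g n)}
    (hφ : φ ∈ (staircase g n hn).cocycles) {p : ℕ × ℕ}
    (h : p.1 < g ∧ p.2 ≤ n ∧ (p.2 = n → p.1 + 1 < g)) :
    ext φ.1 p + ext φ.2 (next g n 1 p) = ext φ.1 (prev g n 0 p) + ext φ.2 p := by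
  have := congrFun (LinearMap.mem_ker.1 hφ) ⟨p, h⟩
  have e1 := ext_coe φ.2 ((staircase g n hn).right ⟨p, h⟩)
  have e2 := ext_coe φ.1 ((staircase g n hn).up ⟨p, h⟩)
  rw [right_coe] at e1
  rw [up_coe] at e2
  simp only [Origami.coboundary, LinearMap.coe_mk, AddHom.coe_mk, Pi.zero_apply] at this
  rw [ext_of_valid φ.1 h, ext_of_valid φ.2 h, e1, e2]
  linarith

/-- In a square of a long rectangle the two sides parallel to the strip are the same edge and cancel
in the coboundary, so closedness equates the two transverse sides. -/
theorem ext_trans_long {hn : 0 < n} {φ : Origami.Cochain (StairSq g n)}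
    (hφ : φ ∈ (staircase g n hn).cocycles) {j k : ℕ} (hk : k < n) :
    ext (trans φ j) (j, k) = transValue φ j := by
  by_cases hj : j < g
  swap
  · rw [transValue, ext_of_not_valid _ (by grind), ext_of_not_valid _ (by grind)]
  unfold transValue
  induction k with
  | zero => rfl
  | succ k ih =>
    rw [← ih (by omega)]
    rcases Nat.mod_two_eq_zero_or_one j with e | e
    · have := cocycle_eq hφ (p := (j, k + 1)) (by grind)
      have h1 : next g n 1 (j, k + 1) = (j, k + 1) := by simp only [next]; grind
      have h2 : prev g n 0 (j, k + 1) = (j, k) := by simp only [prev, first]; grind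
      rw [h1, h2] at this
      simp only [trans, e, if_true]
      linarith
    · have := cocycle_eq hφ (p := (j, k)) (by grind)
      have h1 : next g n 1 (j, k) = (j, k + 1) := by simp only [next, last]; grind
      have h2 : prev g n 0 (j, k) = (j, k) := by simp only [prev]; grind
      rw [h1, h2] at this
      simp only [trans, e]
      simp
      linarith

/-- The relation at a corner square mixes both directions: equality of one pair of opposite sides
yields equality of the other. The first strip starts without a corner, so the information propagates
down the staircase by induction. The third conjunct is what the step from a horizontal to a vertical
strip consumes. -/
theorem ext_trans_corner_aux {hn : 0 < n} {φ : Origami.Cochain (StairSq g n)}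
    (hφ : φ ∈ (staircase g n hn).cocycles) (j : ℕ) (hj : j + 1 < g) :
    ext (trans φ j) (j, n) = transValue φ j ∧
      ext (trans φ (j + 1)) (j, n) = transValue φ (j + 1) ∧
      ext (trans φ j) (first n j) = transValue φ j := by
  induction j with
  | zero =>
    have hl := ext_trans_long hφ (j := 0) (k := n - 1) (by omega)
    have hl0 := ext_trans_long hφ (j := 0) (k := 0) (by omega)
    have hl1 := ext_trans_long hφ (j := 1) (k := 0) (by omega)
    have c1 := cocycle_eq hφ (p := (0, 0)) (by grind)
    have c2 := cocycle_eq hφ (p := (0, n)) (by grind)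
    have h1 : next g n 1 (0, 0) = (0, 0) := by simp only [next]; grind
    have h2 : prev g n 0 (0, 0) = (0, n) := by simp only [prev, first, last]; grind
    have h3 : next g n 1 (0, n) = (1, 0) := by simp only [next]; grind
    have h4 : prev g n 0 (0, n) = (0, n - 1) := by simp only [prev]; grind
    rw [h1, h2] at c1
    rw [h3, h4] at c2
    simp [trans, first] at *
    refine ⟨?_, ?_, ?_⟩ <;> linarith
  | succ j ih =>
    obtain ⟨i1, i2, i3⟩ := ih (by omega)
    have hl := ext_trans_long hφ (j := j + 1) (k := n - 1) (by omega)
    have hl0 := ext_trans_long hφ (j := j + 1) (k := 0) (by omega)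
    have hl1 := ext_trans_long hφ (j := j + 2) (k := 0) (by omega)
    have c2 := cocycle_eq hφ (p := (j + 1, n)) (by grind)
    rcases Nat.mod_two_eq_zero_or_one j with e | e
    -- The strip `j + 1` is horizontal: the squares of long rectangles just before and just after
    -- the corner `(j + 1, n)` already determine both of its values.
    · have e1 : (j + 1) % 2 = 1 := by omega
      have c1 := cocycle_eq hφ (p := (j + 2, 0)) (by grind)
      have c3 := cocycle_eq hφ (p := (j + 1, n - 1)) (by grind)
      have h1 : next g n 1 (j + 2, 0) = (j + 2, 0) := by simp only [next]; grind
      have h2 : prev g n 0 (j + 2, 0) = (j + 1, n) := by simp only [prev, first, last]; grind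
      have h3 : next g n 1 (j + 1, n - 1) = (j + 1, n) := by simp only [next, last]; grind
      have h4 : prev g n 0 (j + 1, n - 1) = (j + 1, n - 1) := by simp only [prev]; grind
      rw [h1, h2] at c1
      rw [h3, h4] at c3
      have e2 : (j + 1 + 1) % 2 = 0 := by omega
      simp [trans, e, e1, e2, first] at *
      refine ⟨?_, ?_, ?_⟩ <;> linarith
    -- The strip `j + 1` is vertical: its last square is reached only by going up from the corner
    -- `(j, n)`, whose mixed relation is resolved by the inductive hypothesis.
    · have e1 : (j + 1) % 2 = 0 := by omega
      have c3 := cocycle_eq hφ (p := (j, n)) (by grind)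
      have h1 : next g n 1 (j, n) = first n j := by simp only [next]; grind
      have h2 : prev g n 0 (j, n) = last g n (j + 1) := by simp only [prev]; grind
      have h3 : next g n 1 (j + 1, n) = (j + 2, 0) := by simp only [next]; grind
      have h4 : prev g n 0 (j + 1, n) = (j + 1, n - 1) := by simp only [prev]; grind
      have h5 : last g n (j + 1) = (j + 1, n) := by simp only [last]; grind
      have e2 : (j + 1 + 1) % 2 = 1 := by omega
      rw [h1, h2, h5] at c3
      rw [h3, h4] at c2
      simp only [trans, e, e1, e2, if_true, one_ne_zero, if_false, Nat.add_assoc, Nat.reduceAdd]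
        at *
      have h6 : first n (j + 1) = (j, n) := by simp [first]
      rw [h6]
      refine ⟨?_, ?_, ?_⟩ <;> linarith

theorem ext_trans_corner {hn : 0 < n} {φ : Origami.Cochain (StairSq g n)}
    (hφ : φ ∈ (staircase g n hn).cocycles) {j : ℕ} (hj : j + 1 < g) :
    ext (trans φ j) (j, n) = transValue φ j := (ext_trans_corner_aux hφ j hj).1

theorem ext_trans_succ_corner {hn : 0 < n} {φ : Origami.Cochain (StairSq g n)}
    (hφ : φ ∈ (staircase g n hn).cocycles) {j : ℕ} (hj : j + 1 < g) :
    ext (trans φ (j + 1)) (j, n) = transValue φ (j + 1) := (ext_trans_corner_aux hφ j hj).2.1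

theorem cocycle_right {hn : 0 < n} {φ : Origami.Cochain (StairSq g n)}
    (hφ : φ ∈ (staircase g n hn).cocycles) (q : StairSq g n) :
    φ.2 ((staircase g n hn).right q) = φ.2 q := by
  rw [← ext_coe φ.2 q, ← ext_coe φ.2, right_coe]
  obtain ⟨⟨j, k⟩, h1, h2, h3⟩ := q
  simp only at h1 h2 h3 ⊢
  have key : j % 2 = 1 → ext φ.2 (first n j) = transValue φ j := by
    intro e
    obtain ⟨i, rfl⟩ : ∃ i, j = i + 1 := ⟨j - 1, by omega⟩
    have := ext_trans_succ_corner hφ (j := i) h1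
    simpa [first, trans, e] using this
  rcases h2.lt_or_eq with hk | rfl
  · rcases Nat.mod_two_eq_zero_or_one j with e | e
    · have : next g n 1 (j, k) = (j, k) := by simp only [next]; grind
      rw [this]
    · have hl := ext_trans_long hφ (j := j) hk
      simp only [trans, e, one_ne_zero, if_false] at hl
      rw [hl]
      by_cases hk' : k + 1 < n
      · have : next g n 1 (j, k) = (j, k + 1) := by simp only [next, last]; grind
        rw [this]
        have hl := ext_trans_long hφ (j := j) hk'
        simpa only [trans, e, one_ne_zero, if_false] using hl
      · by_cases hj : j + 1 < g
        · have : next g n 1 (j, k) = (j, n) := by simp only [next, last]; grind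
          rw [this]
          have hl := ext_trans_corner hφ (j := j) hj
          simpa only [trans, e, one_ne_zero, if_false] using hl
        · have : next g n 1 (j, k) = first n j := by simp only [next, last]; grind
          rw [this, key e]
  · rcases Nat.mod_two_eq_zero_or_one j with e | e
    · have : next g k 1 (j, k) = (j + 1, 0) := by simp only [next]; grind
      rw [this]
      have e' : (j + 1) % 2 = 1 := by omega
      have hl := ext_trans_long hφ (j := j + 1) (k := 0) hn
      have hc := ext_trans_succ_corner hφ (j := j) (h3 rfl)
      simp only [trans, e', one_ne_zero, if_false] at hl hc
      rw [hl, hc]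
    · have : next g k 1 (j, k) = first k j := by simp only [next]; grind
      rw [this, key e]
      have hc := ext_trans_corner hφ (j := j) (h3 rfl)
      simp only [trans, e, one_ne_zero, if_false] at hc
      rw [hc]

theorem cocycle_up {hn : 0 < n} {φ : Origami.Cochain (StairSq g n)}
    (hφ : φ ∈ (staircase g n hn).cocycles) (q : StairSq g n) :
    φ.1 ((staircase g n hn).up q) = φ.1 q := by
  have := congrFun (LinearMap.mem_ker.1 hφ) q
  simp only [Origami.coboundary, LinearMap.coe_mk, AddHom.coe_mk, Pi.zero_apply,
    cocycle_right hφ q] at this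
  linarith

/-! ### The cup product in strip coordinates -/

theorem ext_wedge (a b c d : StairSq g n → ℝ) (p : ℕ × ℕ) :
    ext (fun q => a q * b q - c q * d q) p = ext a p * ext b p - ext c p * ext d p := by
  unfold ext
  split_ifs <;> simp

theorem ext_corner_eq_zero {E : Type*} [Zero E] (f : StairSq g n → E) {j : ℕ} (hj : ¬ j + 1 < g) :
    ext f (j, n) = 0 := ext_of_not_valid f (by grind)

theorem transValue_eq_zero (φ : Origami.Cochain (StairSq g n)) {j : ℕ} (hj : ¬ j < g) :
    transValue φ j = 0 := ext_of_not_valid _ (by grind)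

theorem cup_eq_sum {hn : 0 < n} (φ : Origami.Cochain (StairSq g n))
    {ψ : Origami.Cochain (StairSq g n)} (hψ : ψ ∈ (staircase g n hn).cocycles) :
    (staircase g n hn).cup φ ψ = ∑ q, (φ.1 q * ψ.2 q - φ.2 q * ψ.1 q) := by
  simp only [Origami.cup, LinearMap.mk₂_apply]
  exact sum_congr rfl fun q _ => by rw [cocycle_right hψ, cocycle_up hψ]

/-- The sign alternates because horizontal and vertical exchange roles from one strip to the next.
In a long rectangle the transverse value factors out of the sum; a corner square pairs the
transverse values of the two strips crossing there. For the last `j` there is no corner, and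
`transValue` at `j + 1` is zero by default. -/
theorem cup_eq {hn : 0 < n} {φ ψ : Origami.Cochain (StairSq g n)}
    (hφ : φ ∈ (staircase g n hn).cocycles) (hψ : ψ ∈ (staircase g n hn).cocycles) :
    (staircase g n hn).cup φ ψ = ∑ j ∈ range g, (-1 : ℝ) ^ j *
      (transValue φ j * longValue ψ j - longValue φ j * transValue ψ j
        + (transValue φ j * transValue ψ (j + 1) - transValue φ (j + 1) * transValue ψ j)) := by
  rw [cup_eq_sum φ hψ, sum_eq_sum_ext]
  refine sum_congr rfl fun j _ => ?_
  simp only [ext_wedge, longValue]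
  have hw : ∀ p, ext φ.1 p * ext ψ.2 p - ext φ.2 p * ext ψ.1 p = (-1) ^ j *
      (ext (trans φ j) p * ext (trans ψ (j + 1)) p
        - ext (trans φ (j + 1)) p * ext (trans ψ j) p) := by
    intro p
    rcases Nat.even_or_odd j with e | e
    · have e1 := Nat.even_iff.1 e
      have e2 : (j + 1) % 2 = 1 := by omega
      simp [trans, e1, e2, e.neg_one_pow]
    · have e1 := Nat.odd_iff.1 e
      have e2 : (j + 1) % 2 = 0 := by omega
      simp [trans, e1, e2, e.neg_one_pow]
  simp only [hw]
  rw [← mul_sum, ← mul_add]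
  congr 2
  · rw [sum_sub_distrib, mul_sum, sum_mul]
    congr 1
    · exact sum_congr rfl fun k hk => by rw [ext_trans_long hφ (mem_range.1 hk)]
    · exact sum_congr rfl fun k hk => by rw [ext_trans_long hψ (mem_range.1 hk)]
  · by_cases hj : j + 1 < g
    · rw [ext_trans_corner hφ hj, ext_trans_corner hψ hj, ext_trans_succ_corner hφ hj,
        ext_trans_succ_corner hψ hj]
    · simp [ext_corner_eq_zero _ hj, transValue_eq_zero _ hj]

/-! ### Integrals of cocycles and displacements -/

/-- The displacement vector of a list of chords inside a square. -/
noncomputable def displacement (l : List (Origami.Chord (StairSq g n))) (q : StairSq g n) : ℂ :=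
  open Classical in (l.map fun c => if c.sq = q then (⟨c.dx, c.dy⟩ : ℂ) else 0).sum

/-- The length of the part of a list of chords inside a square. -/
noncomputable def lengthIn (l : List (Origami.Chord (StairSq g n))) (q : StairSq g n) : ℝ :=
  open Classical in (l.map fun c => if c.sq = q then c.length else 0).sum

theorem norm_displacement_le (l : List (Origami.Chord (StairSq g n))) (q : StairSq g n) :
    ‖displacement l q‖ ≤ lengthIn l q := by
  unfold displacement lengthIn
  induction l with
  | nil => simp
  | cons c l ih =>
    simp only [List.map_cons, List.sum_cons]
    refine (norm_add_le _ _).trans (add_le_add ?_ ih)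
    split_ifs
    · rw [Complex.norm_eq_sqrt_sq_add_sq, Origami.Chord.length]
    · simp

theorem sum_lengthIn (l : List (Origami.Chord (StairSq g n))) :
    ∑ q, lengthIn l q = (l.map Origami.Chord.length).sum := by
  classical
  unfold lengthIn
  induction l with
  | nil => simp
  | cons c l ih => simp [sum_add_distrib, ← ih]

/-- Since opposite sides of a square carry equal values, the `x * y` terms of the primitive cancel
and it is linear on each square. -/
theorem integral_cocycle {hn : 0 < n} {φ : Origami.Cochain (StairSq g n)}
    (hφ : φ ∈ (staircase g n hn).cocycles) (l : List (Origami.Chord (StairSq g n))) :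
    (staircase g n hn).integral l φ
      = ∑ q, (φ.1 q * (displacement l q).re + φ.2 q * (displacement l q).im) := by
  classical
  unfold displacement
  induction l with
  | nil => simp [Origami.integral]
  | cons c l ih =>
    have hstep : (staircase g n hn).integral (c :: l) φ
        = ((staircase g n hn).primitive (c.sq, c.tgt) - (staircase g n hn).primitive (c.sq, c.src)) φ
          + (staircase g n hn).integral l φ := by
      simp only [Origami.integral, List.map_cons, List.sum_cons, LinearMap.add_apply]
    rw [hstep, ih]
    have hc : ((staircase g n hn).primitive (c.sq, c.tgt)
        - (staircase g n hn).primitive (c.sq, c.src)) φ = φ.1 c.sq * c.dx + φ.2 c.sq * c.dy := by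
      simp only [LinearMap.sub_apply, Origami.primitive, LinearMap.coe_mk, AddHom.coe_mk,
        cocycle_right hφ, Origami.Chord.dx, Origami.Chord.dy]
      ring
    rw [hc]
    simp only [List.map_cons, List.sum_cons, Complex.add_re, Complex.add_im, mul_add,
      sum_add_distrib, apply_ite Complex.re, apply_ite Complex.im, Complex.zero_re, Complex.zero_im,
      mul_ite, mul_zero, sum_ite_eq, mem_univ, if_true]
    ring

/-! ### Test cocycles: single edges and whole strips -/

/-- The component of a vector transverse to the strips of the parity of `j`. -/
def transPart (j : ℕ) (z : ℂ) : ℝ := if j % 2 = 0 then z.re else z.im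

/-- The cochain with the given values on the edges transverse to the strips of the parity of
`j`, and zero on the other edges. -/
def transCochain (j : ℕ) (f : StairSq g n → ℝ) : Origami.Cochain (StairSq g n) :=
  if j % 2 = 0 then (f, 0) else (0, f)

theorem integral_transCochain {hn : 0 < n} {j : ℕ} {f : StairSq g n → ℝ}
    (hf : transCochain j f ∈ (staircase g n hn).cocycles)
    (l : List (Origami.Chord (StairSq g n))) :
    (staircase g n hn).integral l (transCochain j f)
      = ∑ q, f q * transPart j (displacement l q) := by
  rw [integral_cocycle hf]
  refine sum_congr rfl fun q _ => ?_
  unfold transCochain transPart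
  split_ifs <;> simp

/-- The edge in question has the same square on both sides, so its two contributions to the
coboundary cancel. -/
theorem transCochain_single_mem (hn : 0 < n) (j : ℕ) (q : StairSq g n) (hj : q.1.1 = j)
    (hk : q.1.2 < n) :
    transCochain (j + 1) (Pi.single q 1) ∈ (staircase g n hn).cocycles := by
  refine LinearMap.mem_ker.2 (funext fun q' => ?_)
  subst hj
  unfold transCochain
  rcases Nat.mod_two_eq_zero_or_one q.1.1 with e | e
  · have e' : (q.1.1 + 1) % 2 = 1 := by omega
    have h : (staircase g n hn).right q = q := Subtype.ext (by rw [right_coe]; simp only [next]; grind)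
    have h' : (staircase g n hn).right q' = q ↔ q' = q := by
      conv_lhs => rw [← h]
      exact (staircase g n hn).right.injective.eq_iff
    simp [e', Origami.coboundary, Pi.single_apply, h']
  · have e' : (q.1.1 + 1) % 2 = 0 := by omega
    have h : (staircase g n hn).up q = q := Subtype.ext (by rw [up_coe]; simp only [prev]; grind)
    have h' : (staircase g n hn).up q' = q ↔ q' = q := by
      conv_lhs => rw [← h]
      exact (staircase g n hn).up.injective.eq_iff
    simp [e', Origami.coboundary, Pi.single_apply, h']

/-- The indicator function of the strip `j`. -/
def stripIndicator (g n j : ℕ) (q : StairSq g n) : ℝ :=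
  if q.1.1 = j ∨ (q.1.1 + 1 = j ∧ q.1.2 = n) then 1 else 0

/-- A strip is invariant under the permutation that moves along it. Up to sign, this cocycle is dual
to the core curve of the strip. -/
theorem transCochain_strip_mem (hn : 0 < n) (j : ℕ) :
    transCochain j (stripIndicator g n j) ∈ (staircase g n hn).cocycles := by
  refine LinearMap.mem_ker.2 (funext fun q => ?_)
  unfold transCochain
  rcases Nat.mod_two_eq_zero_or_one j with e | e
  · have : stripIndicator g n j ((staircase g n hn).up q) = stripIndicator g n j q := by
      unfold stripIndicator
      congr 1
      rw [up_coe]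
      obtain ⟨⟨i, k⟩, h1, h2, h3⟩ := q
      simp only [prev, first, last]
      grind
    simp [e, Origami.coboundary, this]
  · have : stripIndicator g n j ((staircase g n hn).right q) = stripIndicator g n j q := by
      unfold stripIndicator
      congr 1
      rw [right_coe]
      obtain ⟨⟨i, k⟩, h1, h2, h3⟩ := q
      simp only [next, first, last]
      grind
    simp [e, Origami.coboundary, this]

theorem cup_transCochain {hn : 0 < n} (j : ℕ) (f : StairSq g n → ℝ)
    {ψ : Origami.Cochain (StairSq g n)} (hψ : ψ ∈ (staircase g n hn).cocycles) :
    (staircase g n hn).cup (transCochain j f) ψ = (-1) ^ j * ∑ q, f q * trans ψ (j + 1) q := by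
  rw [cup_eq_sum _ hψ, mul_sum]
  refine sum_congr rfl fun q _ => ?_
  rcases Nat.even_or_odd j with e | e
  · have e1 := Nat.even_iff.1 e
    have e2 : (j + 1) % 2 = 1 := by omega
    simp [trans, transCochain, e1, e2, e.neg_one_pow]
  · have e1 := Nat.odd_iff.1 e
    have e2 : (j + 1) % 2 = 0 := by omega
    simp [trans, transCochain, e1, e2, e.neg_one_pow]

/-- The value of a sequence at the previous index, zero if there is none. -/
def atPred (f : ℕ → ℝ) : ℕ → ℝ
  | 0 => 0
  | j + 1 => f j

theorem sum_stripIndicator_mul (f : StairSq g n → ℝ) {j : ℕ} (hj : j < g) :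
    ∑ q, stripIndicator g n j q * f q
      = ∑ k ∈ range n, ext f (j, k) + ext f (j, n) + atPred (fun i => ext f (i, n)) j := by
  have h : ∀ p : ℕ × ℕ, ext (fun q => stripIndicator g n j q * f q) p
      = if p.1 = j ∨ (p.1 + 1 = j ∧ p.2 = n) then ext f p else 0 := by
    intro p
    unfold ext stripIndicator
    split_ifs <;> simp_all
  have h1 : ∀ i, ∑ k ∈ range n, ext (fun q => stripIndicator g n j q * f q) (i, k)
      = if i = j then ∑ k ∈ range n, ext f (j, k) else 0 := by
    intro i
    split_ifs with hi
    · subst hi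
      exact sum_congr rfl fun k _ => by rw [h]; simp
    · refine sum_eq_zero fun k hk => ?_
      rw [h, if_neg]
      have := mem_range.1 hk
      grind
  have h2 : ∀ i, ext (fun q => stripIndicator g n j q * f q) (i, n)
      = (if i = j then ext f (j, n) else 0)
        + if i + 1 = j then atPred (fun i => ext f (i, n)) j else 0 := by
    intro i
    rw [h]
    by_cases h3 : i = j
    · subst h3; simp
    · by_cases h4 : i + 1 = j
      · subst h4; simp [atPred]
      · simp [h3, h4]
  rw [sum_eq_sum_ext]
  simp only [h1, h2, sum_add_distrib]
  rw [sum_ite_eq' (range g) j, sum_ite_eq' (range g) j, if_pos (mem_range.2 hj),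
    if_pos (mem_range.2 hj), add_assoc]
  congr 2
  cases j with
  | zero => simp [atPred]
  | succ j => simp [show j < g by omega]

/-! ### Coordinates of a Poincaré dual -/

variable {hn : 0 < n} {γ : Origami.PolyPath (staircase g n hn)}
  {η : Origami.Cochain (StairSq g n)}

theorem transPart_zero (j : ℕ) : transPart j 0 = 0 := by simp [transPart]

theorem transPart_sum (j : ℕ) (s : Finset ℕ) (z : ℕ → ℂ) :
    transPart j (∑ k ∈ s, z k) = ∑ k ∈ s, transPart j (z k) := by
  unfold transPart; split_ifs <;> simp

theorem ext_comp_transPart (j : ℕ) (f : StairSq g n → ℂ) (p : ℕ × ℕ) :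
    ext (fun q => transPart j (f q)) p = transPart j (ext f p) := by
  unfold ext; split_ifs <;> simp [transPart_zero]

theorem abs_transPart_le (j : ℕ) (z : ℂ) : |transPart j z| ≤ ‖z‖ := by
  unfold transPart; split_ifs
  · exact Complex.abs_re_le_norm z
  · exact Complex.abs_im_le_norm z

/-- Up to sign, the determinant is the imaginary part of `z` times the conjugate of `w`. -/
theorem abs_wedge_le (j : ℕ) (z w : ℂ) :
    |transPart (j + 1) z * transPart j w - transPart j z * transPart (j + 1) w| ≤ ‖z‖ * ‖w‖ := by
  have h1 : |z.im * w.re - z.re * w.im| ≤ ‖z‖ * ‖w‖ := by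
    have h := Complex.abs_im_le_norm (z * (starRingEnd ℂ) w)
    rw [norm_mul, Complex.norm_conj] at h
    convert h using 2
    simp
    ring
  unfold transPart
  rcases Nat.mod_two_eq_zero_or_one j with e | e
  · have e2 : (j + 1) % 2 = 1 := by omega
    simpa [e, e2] using h1
  · have e2 : (j + 1) % 2 = 0 := by omega
    rw [abs_sub_comm] at h1
    simpa [e, e2] using h1

/-- The displacement of a path in the long rectangle `j`. -/
noncomputable def longDisplacement (γ : Origami.PolyPath (staircase g n hn)) (j : ℕ) : ℂ :=
  ∑ k ∈ range n, ext (displacement γ.chords) (j, k)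

/-- The displacement of a path in the corner square `j`. -/
noncomputable def cornerDisplacement (γ : Origami.PolyPath (staircase g n hn)) (j : ℕ) : ℂ :=
  ext (displacement γ.chords) (j, n)

/-- Test against the edge of the square `(j, k)` parallel to the strip. The left side does not
involve `k`: the curve advances equally along the strip in all `n` squares. -/
theorem transValue_dual_eq (h : Origami.IsPoincareDual γ η) {j k : ℕ} (hj : j < g) (hk : k < n) :
    transValue η j = -(-1) ^ j * transPart (j + 1) (ext (displacement γ.chords) (j, k)) := by
  classical
  have hv : (j, k).1 < g ∧ (j, k).2 ≤ n ∧ ((j, k).2 = n → (j, k).1 + 1 < g) := by grind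
  have hm := transCochain_single_mem hn j ⟨(j, k), hv⟩ rfl hk
  have hd := h.2 _ hm
  rw [integral_transCochain hm, cup_transCochain _ _ h.1, trans_add_two] at hd
  simp only [Pi.single_apply, ite_mul, one_mul, zero_mul, sum_ite_eq', mem_univ, if_true] at hd
  rw [← ext_trans_long h.1 (j := j) hk, ext_of_valid _ hv, ext_of_valid _ hv, hd, pow_succ]
  have : ((-1 : ℝ) ^ j) * (-1) ^ j = 1 := by rw [← mul_pow]; simp
  linear_combination (-trans η j ⟨(j, k), hv⟩) * this

theorem natCast_mul_transValue_dual (h : Origami.IsPoincareDual γ η) {j : ℕ} (hj : j < g) :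
    n * transValue η j = -(-1) ^ j * transPart (j + 1) (longDisplacement γ j) := by
  rw [longDisplacement, transPart_sum, mul_sum, ← sum_congr rfl fun k hk =>
    transValue_dual_eq h hj (mem_range.1 hk)]
  simp

/-- Test against the strip: the left side is the period of `η` along the core curve, each corner
square contributing the transverse value of the other strip through it. -/
theorem longValue_dual_eq (h : Origami.IsPoincareDual γ η) {j : ℕ} (hj : j < g) :
    longValue η j + transValue η (j + 1) + atPred (transValue η) j
      = (-1) ^ j * (transPart j (longDisplacement γ j) + transPart j (cornerDisplacement γ j)
        + atPred (fun i => transPart j (cornerDisplacement γ i)) j) := by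
  have hm := transCochain_strip_mem (g := g) hn j
  have hd := h.2 _ hm
  rw [integral_transCochain hm, cup_transCochain _ _ h.1, sum_stripIndicator_mul _ hj,
    sum_stripIndicator_mul _ hj] at hd
  simp only [ext_comp_transPart, ← transPart_sum] at hd
  change transPart j (longDisplacement γ j) + transPart j (cornerDisplacement γ j)
        + atPred (fun i => transPart j (cornerDisplacement γ i)) j = _ at hd
  have h1 : ext (trans η (j + 1)) (j, n) = transValue η (j + 1) := by
    by_cases hj' : j + 1 < g
    · exact ext_trans_succ_corner h.1 hj'
    · rw [ext_corner_eq_zero _ hj', transValue_eq_zero _ hj']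
  have h2 : atPred (fun i => ext (trans η (j + 1)) (i, n)) j = atPred (transValue η) j := by
    cases j with
    | zero => rfl
    | succ j => simpa only [atPred, trans_add_two] using ext_trans_corner h.1 hj
  rw [hd, h1, h2, ← mul_assoc, ← mul_pow]
  simp [longValue]

/-! ### Lengths and the intersection estimate -/

/-- The length of a path in the long rectangle `j`. -/
noncomputable def longLength (γ : Origami.PolyPath (staircase g n hn)) (j : ℕ) : ℝ :=
  ∑ k ∈ range n, ext (lengthIn γ.chords) (j, k)

/-- The length of a path in the corner square `j`. -/
noncomputable def cornerLength (γ : Origami.PolyPath (staircase g n hn)) (j : ℕ) : ℝ :=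
  ext (lengthIn γ.chords) (j, n)

theorem norm_ext_displacement_le (γ : Origami.PolyPath (staircase g n hn)) (p : ℕ × ℕ) :
    ‖ext (displacement γ.chords) p‖ ≤ ext (lengthIn γ.chords) p := by
  unfold ext
  split_ifs
  · exact norm_displacement_le _ _
  · simp

theorem norm_longDisplacement_le (γ : Origami.PolyPath (staircase g n hn)) (j : ℕ) :
    ‖longDisplacement γ j‖ ≤ longLength γ j :=
  (norm_sum_le _ _).trans (sum_le_sum fun _ _ => norm_ext_displacement_le γ _)

theorem norm_cornerDisplacement_le (γ : Origami.PolyPath (staircase g n hn)) (j : ℕ) :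
    ‖cornerDisplacement γ j‖ ≤ cornerLength γ j := norm_ext_displacement_le γ _

theorem sum_longLength_add_cornerLength (γ : Origami.PolyPath (staircase g n hn)) :
    ∑ j ∈ range g, (longLength γ j + cornerLength γ j) = γ.length := by
  rw [Origami.PolyPath.length, ← sum_lengthIn, sum_eq_sum_ext]
  rfl

/-- In the product of two sums of nonnegative terms indexed by the long rectangles and the corner
squares, the pairs of adjacent pieces contribute at most the whole product. -/
theorem sum_adjacent_le {L K L' K' : ℕ → ℝ} (hL : ∀ j, 0 ≤ L j) (hK : ∀ j, 0 ≤ K j)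
    (hL' : ∀ j, 0 ≤ L' j) (hK' : ∀ j, 0 ≤ K' j) (m : ℕ) :
    ∑ j ∈ range m, (L j * L' j + L j * (K' j + atPred K' j) + (K j + atPred K j) * L' j
      + L j * atPred L' j + atPred L j * L' j)
      ≤ (∑ j ∈ range m, (L j + K j)) * ∑ j ∈ range m, (L' j + K' j) := by
  induction m with
  | zero => simp
  | succ m ih =>
    -- The pieces with index `m` meet earlier pieces only at index `m - 1`, and those are part of
    -- the previous total.
    have hp : ∀ {A B : ℕ → ℝ}, (∀ j, 0 ≤ A j) → (∀ j, 0 ≤ B j) →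
        atPred A m + atPred B m ≤ ∑ j ∈ range m, (A j + B j) := by
      intro A B hA hB
      cases m with
      | zero => simp [atPred]
      | succ m =>
        rw [sum_range_succ]
        exact le_add_of_nonneg_left (sum_nonneg fun j _ => add_nonneg (hA j) (hB j))
    have h1 := mul_le_mul_of_nonneg_left (hp hL' hK') (hL m)
    have h2 := mul_le_mul_of_nonneg_left (hp hL hK) (hL' m)
    have h3 : 0 ≤ ∑ j ∈ range m, (L j + K j) := sum_nonneg fun j _ => add_nonneg (hL j) (hK j)
    have h4 : 0 ≤ ∑ j ∈ range m, (L' j + K' j) := sum_nonneg fun j _ => add_nonneg (hL' j) (hK' j)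
    have h5 := mul_nonneg h3 (hK' m)
    have h6 := mul_nonneg h4 (hK m)
    have h7 := mul_nonneg (hK m) (hK' m)
    rw [sum_range_succ, sum_range_succ, sum_range_succ]
    linarith

/-- The factor `n` is given away here: this bound serves for neighbouring long rectangles, whose
products have room in the product of the lengths. -/
theorem abs_transValue_dual_le (h : Origami.IsPoincareDual γ η) (j : ℕ) :
    |transValue η j| ≤ longLength γ j := by
  have hnn : 0 ≤ longLength γ j := (norm_nonneg _).trans (norm_longDisplacement_le γ j)
  by_cases hj : j < g
  · have hd := natCast_mul_transValue_dual h hj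
    have hb := (abs_transPart_le (j + 1) _).trans (norm_longDisplacement_le γ j)
    have : |(n : ℝ) * transValue η j| ≤ longLength γ j := by
      rw [hd, abs_mul]; simpa using hb
    rw [abs_mul, Nat.abs_cast] at this
    have h1 : (1 : ℝ) ≤ n := by exact_mod_cast hn
    nlinarith [abs_nonneg (transValue η j)]
  · rwa [transValue_eq_zero _ hj, abs_zero]

theorem abs_atPred_le {f F : ℕ → ℝ} (h : ∀ j, |f j| ≤ F j) (j : ℕ) :
    |atPred f j| ≤ atPred F j := by
  cases j with
  | zero => simp [atPred]
  | succ j => exact h j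

theorem abs_mul_le_mul {a b A B : ℝ} (ha : |a| ≤ A) (hb : |b| ≤ B) : |a * b| ≤ A * B := by
  rw [abs_mul]
  exact mul_le_mul ha hb (abs_nonneg b) ((abs_nonneg a).trans ha)

theorem natCast_mul_abs_cup_le {δ : Origami.PolyPath (staircase g n hn)}
    {θ : Origami.Cochain (StairSq g n)}
    (hη : Origami.IsPoincareDual γ η) (hθ : Origami.IsPoincareDual δ θ) :
    n * |(staircase g n hn).cup η θ| ≤ γ.length * δ.length := by
  have nnL : ∀ (γ : Origami.PolyPath (staircase g n hn)) j, 0 ≤ longLength γ j := fun γ j =>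
    (norm_nonneg _).trans (norm_longDisplacement_le γ j)
  have nnK : ∀ (γ : Origami.PolyPath (staircase g n hn)) j, 0 ≤ cornerLength γ j := fun γ j =>
    (norm_nonneg _).trans (norm_cornerDisplacement_le γ j)
  rw [← Nat.abs_cast, ← abs_mul, cup_eq hη.1 hθ.1, mul_sum, ← sum_longLength_add_cornerLength γ,
    ← sum_longLength_add_cornerLength δ]
  refine (abs_sum_le_sum_abs _ _).trans (le_trans (sum_le_sum fun j hj => ?_)
    (sum_adjacent_le (nnL γ) (nnK γ) (nnL δ) (nnK δ) g))
  rw [mem_range] at hj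
  have e1 := natCast_mul_transValue_dual hη hj
  have e2 := natCast_mul_transValue_dual hθ hj
  have e3 := longValue_dual_eq hη hj
  have e4 := longValue_dual_eq hθ hj
  have bL : ∀ (γ : Origami.PolyPath (staircase g n hn)) i,
      |transPart i (longDisplacement γ j)| ≤ longLength γ j :=
    fun γ i => (abs_transPart_le i _).trans (norm_longDisplacement_le γ j)
  have bK : ∀ (γ : Origami.PolyPath (staircase g n hn)) i,
      |transPart j (cornerDisplacement γ i)| ≤ cornerLength γ i :=
    fun γ i => (abs_transPart_le j _).trans (norm_cornerDisplacement_le γ i)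
  have w := (abs_wedge_le j (longDisplacement γ j) (longDisplacement δ j)).trans
    (mul_le_mul (norm_longDisplacement_le γ j) (norm_longDisplacement_le δ j) (norm_nonneg _)
      (nnL γ j))
  have b1 := abs_mul_le_mul (bL γ (j + 1)) (bK δ j)
  have b2 := abs_mul_le_mul (bL γ (j + 1)) (abs_atPred_le (bK δ) j)
  have b3 := abs_mul_le_mul (bK γ j) (bL δ (j + 1))
  have b4 := abs_mul_le_mul (abs_atPred_le (bK γ) j) (bL δ (j + 1))
  have b5 := abs_mul_le_mul (bL γ (j + 1)) (abs_atPred_le (abs_transValue_dual_le hθ) j)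
  have b6 := abs_mul_le_mul (abs_atPred_le (abs_transValue_dual_le hη) j) (bL δ (j + 1))
  generalize transPart (j + 1) (longDisplacement γ j) = l at *
  generalize transPart (j + 1) (longDisplacement δ j) = l' at *
  generalize transPart j (longDisplacement γ j) = t at *
  generalize transPart j (longDisplacement δ j) = t' at *
  generalize transPart j (cornerDisplacement γ j) = c at *
  generalize transPart j (cornerDisplacement δ j) = c' at *
  generalize atPred (fun i => transPart j (cornerDisplacement γ i)) j = p at *
  generalize atPred (fun i => transPart j (cornerDisplacement δ i)) j = p' at *
  generalize atPred (transValue η) j = u at *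
  generalize atPred (transValue θ) j = u' at *
  have e3' : longValue η j = (-1) ^ j * (t + c + p) - transValue η (j + 1) - u := by linarith
  have e4' : longValue θ j = (-1) ^ j * (t' + c' + p') - transValue θ (j + 1) - u' := by linarith
  have hs : ((-1 : ℝ) ^ j) * (-1) ^ j = 1 := by rw [← mul_pow]; simp
  -- Substituting `e3'` and `e4'` cancels the products of the values at `j` and `j + 1`; `n` is then
  -- absorbed by `e1` and `e2`, one factor in each product being a `transValue` at `j`.
  have key : (n : ℝ) * ((-1) ^ j * (transValue η j * longValue θ j - longValue η j * transValue θ j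
      + (transValue η j * transValue θ (j + 1) - transValue η (j + 1) * transValue θ j)))
      = -(-1) ^ j * ((l * t' - t * l') + l * c' + l * p' - c * l' - p * l') + l * u' - u * l' := by
    rw [e3', e4']
    generalize transValue η j = x at *
    generalize transValue θ j = x' at *
    generalize transValue η (j + 1) = y at *
    generalize transValue θ (j + 1) = y' at *
    generalize ((-1 : ℝ) ^ j) = s at *
    linear_combination (s * (s * (t' + c' + p') - u')) * e1 - (s * (s * (t + c + p) - u)) * e2
      + (-s * (l * (t' + c' + p') - (t + c + p) * l') + (l * u' - u * l')) * hs
  rw [key]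
  rw [abs_le] at *
  rcases neg_one_pow_eq_or ℝ j with h | h <;> rw [h] <;> constructor <;> linarith

end Staircase

theorem theorem2p1 (g n : ℕ) (hg : 2 ≤ g) (hn : 2 ≤ n)
    (α β : (staircase g n (Nat.zero_lt_of_lt hn)).SaddleConnection) :
    Staircase.inter (Nat.zero_lt_of_lt hg) (Nat.zero_lt_of_lt hn) α β / (α.length * β.length)
      ≤ 1 / (n : ℝ) * (((n : ℝ) + 1) / n) ^ 2 + 6 / (n : ℝ) ^ 2 := by
  have hn0 : (0 : ℝ) < n := by exact_mod_cast (Nat.zero_lt_of_lt hn)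
  obtain ⟨η, hη⟩ := Origami.exists_poincareDual α.toPolyPath
    (Staircase.saddle_isClosed (Nat.zero_lt_of_lt hg) (Nat.zero_lt_of_lt hn) α)
  obtain ⟨θ, hθ⟩ := Origami.exists_poincareDual β.toPolyPath
    (Staircase.saddle_isClosed (Nat.zero_lt_of_lt hg) (Nat.zero_lt_of_lt hn) β)
  have h := Staircase.natCast_mul_abs_cup_le hη hθ
  rw [Staircase.inter, Origami.algInt_eq _ _ _ _ hη hθ]
  have hl : 0 ≤ α.length * β.length := (by positivity : (0 : ℝ) ≤ n * _).trans h
  have h1 : (staircase g n (Nat.zero_lt_of_lt hn)).cup η θ / (α.length * β.length) ≤ 1 / n := by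
    -- Nonnegativity of the denominator suffices, as a quotient by zero is zero.
    refine div_le_of_le_mul₀ hl (by positivity) ((le_abs_self _).trans ?_)
    rw [one_div_mul_eq_div, le_div_iff₀' hn0]
    exact h
  have h2 : (1 : ℝ) ≤ (((n : ℝ) + 1) / n) ^ 2 :=
    one_le_pow₀ ((one_le_div hn0).2 (by linarith))
  have h3 : 1 / (n : ℝ) ≤ 1 / (n : ℝ) * (((n : ℝ) + 1) / n) ^ 2 :=
    le_mul_of_one_le_right (by positivity) h2
  have h4 : 0 ≤ 6 / (n : ℝ) ^ 2 := by positivity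
  linarith
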